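/- Let $(V,G,W,\mu)$ be a gauged linear sigma model space: $V$ is a noncompact Kähler manifold with Riemannian metric $\langle\cdot,\cdot\rangle$, complex structure $J$ and Kähler form $\omega$, where $\langle\cdot,\cdot\rangle=\omega(\cdot,J\cdot)$; $V$ carries a holomorphic $\mathbb C^*$-action (the $R$-symmetry) and a commuting holomorphic action of a complex reductive Lie group $G$ with maximal compact subgroup $K$, which acts by symplectomorphisms; $W:V\to\mathbb C$ is holomorphic, $G$-invariant, and homogeneous of degree $r\ge 1$ under the $R$-symmetry, i.e. $W(\zeta x)=\zeta^r W(x)$; $\mu:V\to\mathfrak k^*$ is a moment map for the $K$-action, i.e. it is smooth and $K$-equivariant with $d\langle\mu,\xi\rangle=\omega(\mathcal X_\xi,\cdot)$, where $\mathcal X_\xi$ is the infinitesimal action of $\xi\in\mathfrak k$; and $0$ is a regular value of $\mu$. Fix an $\mathrm{Ad}$-invariant inner product on $\mathfrak k$ and use it to identify $\mathfrak k^*$ with $\mathfrak k$. Let $\nabla W$ denote the gradient of $\mathrm{Re}\,W$ (equivalently, the dual of $dW$ under the Hermitian metric with real part $\langle\cdot,\cdot\rangle$). A pointlike instanton is a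 smooth triple $(u,\phi,\psi):\mathbb C\to V\times\mathfrak k\times\mathfrak k$ which solves, with $z=s+it$, the gauged Witten equation $$\partial_s u+\mathcal X_\phi(u)+J(\partial_t u+\mathcal X_\psi(u))+\nabla W(u)=0,\qquad \partial_s\psi-\partial_t\phi+[\phi,\psi]+\mu(u)=0,$$ and is bounded, that is, $\overline{u(\mathbb C)}$ is compact and the energy $$E(u,\phi,\psi)=\tfrac12\left(\|d_Au\|_{L^2}^2+\|F_A\|_{L^2}^2+\|\mu(u)\|_{L^2}^2\right)+\|\nabla W(u)\|_{L^2}^2$$ is finite, where $|d_Au|^2=|\partial_su+\mathcal X_\phi(u)|^2+|\partial_tu+\mathcal X_\psi(u)|^2$ and $F_A=(\partial_s\psi-\partial_t\phi+[\phi,\psi])\,ds\wedge dt$. Then every pointlike instanton satisfies $\nabla W(u)\equiv 0$. Consequently every pointlike instanton is an affine vortex in $V$, i.e. it is a smooth solution of $$\partial_s u+\mathcal X_\phi(u)+J(\partial_t u+\mathcal X_\psi(u))=0,\qquad \partial_s\psi-\partial_t\phi+[\phi,\psi]+\mu(u)=0.$$ -/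

import Mathlib

open scoped Manifold ContDiff ENNReal
open MeasureTheory

/-- The real manifold underlying a complex manifold: a holomorphic atlas is a smooth real atlas. -/
instance instIsManifoldRealOfComplex {E V : Type*} [NormedAddCommGroup E] [NormedSpace ℂ E]
    [TopologicalSpace V] [ChartedSpace E V] [IsManifold 𝓘(ℂ, E) ω V] :
    IsManifold 𝓘(ℝ, E) ∞ V := by
  apply isManifold_of_contDiffOn
  intro e e' he he'
  have h := (contDiffGroupoid ω 𝓘(ℂ, E)).compatible he he'
  rw [contDiffGroupoid, mem_groupoid_of_pregroupoid] at h
  exact (ContDiffOn.restrict_scalars ℝ h.1).of_le le_top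

/-- A positive definite bilinear form on a finite-dimensional real vector space represents every
linear functional. -/
theorem exists_representing_vector {F : Type*} [AddCommGroup F] [Module ℝ F]
    [FiniteDimensional ℝ F] (B : F →ₗ[ℝ] F →ₗ[ℝ] ℝ) (hB : ∀ v, v ≠ 0 → 0 < B v v)
    (l : F →ₗ[ℝ] ℝ) : ∃ v, ∀ w, B v w = l w := by
  have hinj : Function.Injective B := by
    rw [injective_iff_map_eq_zero]
    intro v hv
    by_contra hne
    have := hB v hne
    rw [hv] at this
    simp at this
  obtain ⟨v, hv⟩ := (LinearMap.injective_iff_surjective_of_finrank_eq_finrank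
    (Subspace.dual_finrank_eq (K := ℝ) (V := F)).symm).1 hinj l
  exact ⟨v, fun w => by rw [hv]⟩

noncomputable section

namespace GLSM

section Kahler

variable {E : Type*} [NormedAddCommGroup E] [NormedSpace ℂ E]
  {V : Type*} [TopologicalSpace V] [ChartedSpace E V]

/-- The complex structure `J` on the real tangent space `T_x V` of a complex manifold. -/
def J (x : V) (v : TangentSpace 𝓘(ℝ, E) x) : TangentSpace 𝓘(ℝ, E) x :=
  (Complex.I • (show E from v) : E)

variable (E V) in
/-- A Kähler metric on a complex manifold: a smooth Riemannian metric `g` for which `J` is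
orthogonal and whose fundamental form `ω(v, w) = g(J v, w)`, equivalently `g = ω(·, J ·)`,
is closed. -/
structure KahlerMetric [FiniteDimensional ℂ E] [IsManifold 𝓘(ℂ, E) ω V] where
  /-- the Riemannian metric -/
  metric : Bundle.ContMDiffRiemannianMetric 𝓘(ℝ, E) ∞ E
    (fun x : V => TangentSpace 𝓘(ℝ, E) x)
  inner_J : ∀ (x : V) (v w : TangentSpace 𝓘(ℝ, E) x),
    metric.inner x (J x v) (J x w) = metric.inner x v w
  /-- `dω = 0`, written out in the coordinates given by the chart at `x₀`. -/
  closed : ∀ (x₀ : V),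
    let c : E → V := (extChartAt 𝓘(ℝ, E) x₀).symm
    let om : E → E → E → ℝ := fun a b y =>
      metric.inner (c y) (J (c y) (mfderiv 𝓘(ℝ, E) 𝓘(ℝ, E) c y a))
        (mfderiv 𝓘(ℝ, E) 𝓘(ℝ, E) c y b)
    ∀ y ∈ (extChartAt 𝓘(ℝ, E) x₀).target, ∀ v₁ v₂ v₃ : E,
      fderiv ℝ (om v₂ v₃) y v₁ - fderiv ℝ (om v₁ v₃) y v₂ + fderiv ℝ (om v₁ v₂) y v₃ = 0

/-- The Kähler form `ω(v, w) = g(J v, w)`. -/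
def KahlerMetric.form [FiniteDimensional ℂ E] [IsManifold 𝓘(ℂ, E) ω V] (g : KahlerMetric E V)
    (x : V) (v w : TangentSpace 𝓘(ℝ, E) x) : ℝ :=
  g.metric.inner x (J x v) w

end Kahler

section Groups

variable (EG : Type*) [NormedAddCommGroup EG] [NormedSpace ℂ EG]
  {G : Type*} [TopologicalSpace G] [ChartedSpace EG G] [Group G]
  (EK : Type*) [NormedAddCommGroup EK] [NormedSpace ℝ EK]
  {K : Type*} [TopologicalSpace K] [ChartedSpace EK K] [Group K]

/-- The derivative at the identity, `𝔨 → 𝔤`, of a homomorphism `K → G`. The Lie algebras are the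
tangent spaces at `1`, whose underlying vector spaces are the model spaces `EK` and `EG`. -/
def lieDeriv (ι : K →* G) (ξ : EK) : EG :=
  mfderiv 𝓘(ℝ, EK) 𝓘(ℝ, EG) (fun k : K => ι k) 1 ξ

/-- The homomorphism `ι` from the real Lie group `K` embeds `K` as a maximal compact subgroup of
the complex Lie group `G`, and `G` is reductive, i.e. `G` is a complexification of `K`: it has
finitely many components and `𝔤 = 𝔨 ⊕ i 𝔨`. -/
structure IsReductivePair (ι : K →* G) : Prop where
  smooth : ContMDiff 𝓘(ℝ, EK) 𝓘(ℝ, EG) ∞ (fun k : K => ι k)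
  injective : Function.Injective ι
  maximal_compact : Maximal (fun H : Subgroup G => IsCompact (H : Set G)) ι.range
  finite_components : Finite (ConnectedComponents G)
  complexification : Function.Bijective
    (fun p : EK × EK => (lieDeriv EG EK ι p.1 + Complex.I • lieDeriv EG EK ι p.2 : EG))

variable {EK}

/-- The bracket of `𝔨 = T_1 K`. -/
def bracket (K : Type*) [TopologicalSpace K] [ChartedSpace EK K] [Group K]
    (ξ η : EK) : EK :=
  (⁅(show GroupLieAlgebra 𝓘(ℝ, EK) K from ξ), (show GroupLieAlgebra 𝓘(ℝ, EK) K from η)⁆ :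
    GroupLieAlgebra 𝓘(ℝ, EK) K)

/-- The adjoint action of `K` on `𝔨 = T_1 K`. -/
def Ad (k : K) (ξ : EK) : EK :=
  mfderiv 𝓘(ℝ, EK) 𝓘(ℝ, EK) (fun h : K => k * h * k⁻¹) 1 ξ

variable {E : Type*} [NormedAddCommGroup E] [NormedSpace ℂ E]
  {V : Type*} [TopologicalSpace V] [ChartedSpace E V] [MulAction G V]

/-- The infinitesimal action `𝒳_ξ(x) = d/dt|_{t=0} exp(tξ) x`, for `ξ ∈ 𝔨`, of the `K`-action
`k ↦ ι k • x`, computed as the derivative of the orbit map at `1`. -/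
def infAction (ι : K →* G) (ξ : EK) (x : V) : TangentSpace 𝓘(ℝ, E) x :=
  (mfderiv 𝓘(ℝ, EK) 𝓘(ℝ, E) (fun k : K => ι k • x) 1 ξ : E)

end Groups

/-- A gauged linear sigma model space `(V, G, W, μ)`, where `V` is a noncompact complex manifold
with commuting holomorphic actions of `ℂˣ` (the `R`-symmetry) and of the complex Lie group `G`.
The fields add the remaining data: the Kähler metric, the inclusion `ι` of a maximal compact
subgroup `K` of the reductive group `G`, the superpotential `W`, the moment map `μ : V → 𝔨^*`, and
the invariant inner product on `𝔨` used to identify `𝔨^*` with `𝔨` and to measure norms. -/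
structure GLSMSpace (E : Type*) [NormedAddCommGroup E] [NormedSpace ℂ E] [FiniteDimensional ℂ E]
    (V : Type*) [TopologicalSpace V] [T2Space V] [SecondCountableTopology V] [ChartedSpace E V]
    [IsManifold 𝓘(ℂ, E) ω V] [NoncompactSpace V]
    (EG : Type*) [NormedAddCommGroup EG] [NormedSpace ℂ EG] [FiniteDimensional ℂ EG]
    (G : Type*) [TopologicalSpace G] [T2Space G] [ChartedSpace EG G] [Group G]
    [LieGroup 𝓘(ℂ, EG) ω G]
    (EK : Type*) [NormedAddCommGroup EK] [NormedSpace ℝ EK] [FiniteDimensional ℝ EK]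
    (K : Type*) [TopologicalSpace K] [T2Space K] [CompactSpace K] [ChartedSpace EK K] [Group K]
    [LieGroup 𝓘(ℝ, EK) ∞ K]
    [MulAction ℂˣ V] [ContMDiffSMul 𝓘(ℂ) 𝓘(ℂ, E) ω ℂˣ V]
    [MulAction G V] [ContMDiffSMul 𝓘(ℂ, EG) 𝓘(ℂ, E) ω G V] [SMulCommClass G ℂˣ V] where
  /-- the Kähler structure -/
  kahler : KahlerMetric E V
  /-- the inclusion of the maximal compact subgroup -/
  ι : K →* G
  reductive : IsReductivePair EG EK ι
  /-- `K` acts by symplectomorphisms -/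
  form_invariant : ∀ (k : K) (x : V) (v w : TangentSpace 𝓘(ℝ, E) x),
    kahler.form (ι k • x) (mfderiv 𝓘(ℝ, E) 𝓘(ℝ, E) (fun y : V => ι k • y) x v)
      (mfderiv 𝓘(ℝ, E) 𝓘(ℝ, E) (fun y : V => ι k • y) x w) = kahler.form x v w
  /-- the superpotential -/
  W : V → ℂ
  W_holomorphic : ContMDiff 𝓘(ℂ, E) 𝓘(ℂ) ω W
  W_invariant : ∀ (g : G) (x : V), W (g • x) = W x
  /-- the degree of `W` with respect to the `R`-symmetry -/
  r : ℕ
  one_le_r : 1 ≤ r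
  W_homogeneous : ∀ (ζ : ℂˣ) (x : V), W (ζ • x) = (ζ : ℂ) ^ r * W x
  /-- the moment map -/
  μ : V → (EK →L[ℝ] ℝ)
  μ_smooth : ContMDiff 𝓘(ℝ, E) 𝓘(ℝ, EK →L[ℝ] ℝ) ∞ μ
  /-- `d⟨μ, ξ⟩ = ω(𝒳_ξ, ·)` -/
  μ_moment : ∀ (x : V) (ξ : EK) (v : TangentSpace 𝓘(ℝ, E) x),
    mfderiv 𝓘(ℝ, E) 𝓘(ℝ) (fun y => μ y ξ) x v = kahler.form x (infAction ι ξ x) v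
  μ_equivariant : ∀ (k : K) (x : V) (ξ : EK), μ (ι k • x) (Ad k ξ) = μ x ξ
  zero_regular : ∀ x : V, μ x = 0 →
    Function.Surjective (mfderiv 𝓘(ℝ, E) 𝓘(ℝ, EK →L[ℝ] ℝ) μ x)
  /-- the invariant inner product on `𝔨` -/
  kInner : EK →L[ℝ] EK →L[ℝ] ℝ
  kInner_symm : ∀ ξ η, kInner ξ η = kInner η ξ
  kInner_pos : ∀ ξ, ξ ≠ 0 → 0 < kInner ξ ξ
  kInner_Ad : ∀ (k : K) (ξ η : EK), kInner (Ad k ξ) (Ad k η) = kInner ξ η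

namespace GLSMSpace

variable {E : Type*} [NormedAddCommGroup E] [NormedSpace ℂ E] [FiniteDimensional ℂ E]
    {V : Type*} [TopologicalSpace V] [T2Space V] [SecondCountableTopology V] [ChartedSpace E V]
    [IsManifold 𝓘(ℂ, E) ω V] [NoncompactSpace V]
    {EG : Type*} [NormedAddCommGroup EG] [NormedSpace ℂ EG] [FiniteDimensional ℂ EG]
    {G : Type*} [TopologicalSpace G] [T2Space G] [ChartedSpace EG G] [Group G]
    [LieGroup 𝓘(ℂ, EG) ω G]
    {EK : Type*} [NormedAddCommGroup EK] [NormedSpace ℝ EK] [FiniteDimensional ℝ EK]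
    {K : Type*} [TopologicalSpace K] [T2Space K] [CompactSpace K] [ChartedSpace EK K] [Group K]
    [LieGroup 𝓘(ℝ, EK) ∞ K]
    [MulAction ℂˣ V] [ContMDiffSMul 𝓘(ℂ) 𝓘(ℂ, E) ω ℂˣ V]
    [MulAction G V] [ContMDiffSMul 𝓘(ℂ, EG) 𝓘(ℂ, E) ω G V] [SMulCommClass G ℂˣ V]
    (X : GLSMSpace E V EG G EK K)

theorem exists_gradW (x : V) : ∃ v : TangentSpace 𝓘(ℝ, E) x, ∀ w : TangentSpace 𝓘(ℝ, E) x,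
    X.kahler.metric.inner x v w = mfderiv 𝓘(ℝ, E) 𝓘(ℝ) (fun y => (X.W y).re) x w := by
  have : FiniteDimensional ℝ E := FiniteDimensional.complexToReal E
  have : FiniteDimensional ℝ (TangentSpace 𝓘(ℝ, E) x) := inferInstanceAs (FiniteDimensional ℝ E)
  exact exists_representing_vector
    ((ContinuousLinearMap.coeLM ℝ).comp (X.kahler.metric.inner x).toLinearMap)
    (fun v hv => X.kahler.metric.pos x v hv)
    (mfderiv 𝓘(ℝ, E) 𝓘(ℝ) (fun y => (X.W y).re) x).toLinearMap

/-- The gradient `∇W`, i.e. the gradient of `Re W` for the Kähler metric; equivalently, the vector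
field dual to `dW` under the Hermitian metric with real part `g`. -/
def gradW (x : V) : TangentSpace 𝓘(ℝ, E) x := (X.exists_gradW x).choose

theorem gradW_spec (x : V) (w : TangentSpace 𝓘(ℝ, E) x) :
    X.kahler.metric.inner x (X.gradW x) w =
      mfderiv 𝓘(ℝ, E) 𝓘(ℝ) (fun y => (X.W y).re) x w :=
  (X.exists_gradW x).choose_spec w

theorem exists_sharp (l : EK →L[ℝ] ℝ) : ∃ ξ : EK, ∀ η : EK, X.kInner ξ η = l η :=
  exists_representing_vector ((ContinuousLinearMap.coeLM ℝ).comp X.kInner.toLinearMap)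
    (fun v hv => X.kInner_pos v hv) l.toLinearMap

/-- The identification `𝔨^* → 𝔨` given by the invariant inner product. -/
def sharp (l : EK →L[ℝ] ℝ) : EK := (X.exists_sharp l).choose

theorem sharp_spec (l : EK →L[ℝ] ℝ) (η : EK) : X.kInner (X.sharp l) η = l η :=
  (X.exists_sharp l).choose_spec η

/-- The covariant derivative `u_s = ∂_s u + 𝒳_φ(u)`, where `z = s + i t`. -/
def covS (u : ℂ → V) (φ : ℂ → EK) (z : ℂ) : TangentSpace 𝓘(ℝ, E) (u z) :=
  mfderiv 𝓘(ℝ, ℂ) 𝓘(ℝ, E) u z (1 : ℂ) + infAction X.ι (φ z) (u z)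

/-- The covariant derivative `u_t = ∂_t u + 𝒳_ψ(u)`, where `z = s + i t`. -/
def covT (u : ℂ → V) (ψ : ℂ → EK) (z : ℂ) : TangentSpace 𝓘(ℝ, E) (u z) :=
  mfderiv 𝓘(ℝ, ℂ) 𝓘(ℝ, E) u z Complex.I + infAction X.ι (ψ z) (u z)

/-- The coefficient `∂_s ψ - ∂_t φ + [φ, ψ]` of the curvature `F_A` of `A = d + φ ds + ψ dt`. -/
def curvature (_X : GLSMSpace E V EG G EK K) (φ ψ : ℂ → EK) (z : ℂ) : EK :=
  fderiv ℝ ψ z 1 - fderiv ℝ φ z Complex.I + bracket K (φ z) (ψ z)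

/-- The gauged Witten equation on `ℂ` for a smooth gauged map
`(u, φ, ψ) : ℂ → V × 𝔨 × 𝔨`. -/
structure IsGaugedWittenSolution (u : ℂ → V) (φ ψ : ℂ → EK) : Prop where
  smooth_u : ContMDiff 𝓘(ℝ, ℂ) 𝓘(ℝ, E) ∞ u
  smooth_φ : ContDiff ℝ ∞ φ
  smooth_ψ : ContDiff ℝ ∞ ψ
  witten_eq : ∀ z, X.covS u φ z + J (u z) (X.covT u ψ z) + X.gradW (u z) = 0
  curvature_eq : ∀ z, X.curvature φ ψ z + X.sharp (X.μ (u z)) = 0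

/-- An affine vortex: a smooth gauged map on `ℂ` solving the symplectic vortex equation, in which
no superpotential appears. -/
structure IsAffineVortex (u : ℂ → V) (φ ψ : ℂ → EK) : Prop where
  smooth_u : ContMDiff 𝓘(ℝ, ℂ) 𝓘(ℝ, E) ∞ u
  smooth_φ : ContDiff ℝ ∞ φ
  smooth_ψ : ContDiff ℝ ∞ ψ
  vortex_eq : ∀ z, X.covS u φ z + J (u z) (X.covT u ψ z) = 0
  curvature_eq : ∀ z, X.curvature φ ψ z + X.sharp (X.μ (u z)) = 0

/-- The squared length of a tangent vector of `V`. -/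
def normSq (x : V) (v : TangentSpace 𝓘(ℝ, E) x) : ℝ := X.kahler.metric.inner x v v

/-- The energy density: `|d_A u|² = |u_s|² + |u_t|²`, `|F_A|²` and `|μ(u)|²` with factor `1/2`,
and `|∇W(u)|²` with factor `1`. -/
def energyDensity (u : ℂ → V) (φ ψ : ℂ → EK) (z : ℂ) : ℝ :=
  (1 / 2) * (X.normSq (u z) (X.covS u φ z) + X.normSq (u z) (X.covT u ψ z)
    + X.kInner (X.curvature φ ψ z) (X.curvature φ ψ z)
    + X.kInner (X.sharp (X.μ (u z))) (X.sharp (X.μ (u z))))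
  + X.normSq (u z) (X.gradW (u z))

/-- The energy `E(u, φ, ψ) ∈ [0, ∞]` of a gauged map on `ℂ`. -/
def energy (u : ℂ → V) (φ ψ : ℂ → EK) : ℝ≥0∞ :=
  ∫⁻ z : ℂ, ENNReal.ofReal (X.energyDensity u φ ψ z)

/-- A pointlike instanton, i.e. a bounded solution of the gauged Witten equation on `ℂ`: the
image of `u` has compact closure and the energy is finite. -/
structure IsPointlikeInstanton (u : ℂ → V) (φ ψ : ℂ → EK) : Prop where
  solution : X.IsGaugedWittenSolution u φ ψ
  bounded : IsCompact (closure (Set.range u))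
  finite_energy : X.energy u φ ψ < ⊤

end GLSMSpace

end GLSM

end

/-! The function `W ∘ u` turns the equation into a scalar identity on `ℂ`. Since `W` is
`G`-invariant, `dW` kills the infinitesimal action, so partial derivatives of `W ∘ u` equal `dW` of
the covariant derivatives of `u`. As `dW` is complex linear, applying it to the Witten equation
gives `2 ∂̄(W ∘ u) = -|∇W(u)|²` (`dbar_W_comp`).

By `norm_dW_le` both partial derivatives of `W ∘ u` are bounded by twice the energy density, hence
integrable. The integral of each over the plane is then zero (`integral_partialDeriv_eq_zero`), with
no decay of `W ∘ u` needed. So `∫ |∇W(u)|² = 0`, and the continuous nonnegative integrand vanishes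
everywhere; the Witten equation then becomes the vortex equation. -/

/-! ### Integrals of partial derivatives over the plane. -/

/-- On the plane, the integral of a partial derivative of a function with integrable gradient
vanishes; the function itself need not be integrable. -/
theorem integral_partialDeriv_eq_zero {F : Type*} [NormedAddCommGroup F] [NormedSpace ℝ F]
    [CompleteSpace F] {f a b : ℝ → ℝ → F}
    (hfa : ∀ s t, HasDerivAt (fun s => f s t) (a s t) s)
    (hfb : ∀ s t, HasDerivAt (fun t => f s t) (b s t) t)
    (ha : Integrable (Function.uncurry a) (volume.prod volume))
    (hb : Integrable (Function.uncurry b) (volume.prod volume)) :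
    ∫ p, Function.uncurry a p ∂(volume.prod volume) = 0 := by
  have hga : ∀ᵐ t : ℝ, Integrable (fun s => a s t) := ha.prod_left_ae
  -- The slice integral does not depend on the slice: although `f` need not be integrable on a line,
  -- the difference of `f` on two parallel lines is.
  have hconst : ∀ t t' : ℝ, Integrable (fun s => a s t) → Integrable (fun s => a s t') →
      ∫ s, a s t = ∫ s, a s t' := by
    intro t t' ht ht'
    have hd : ∀ s, HasDerivAt (fun s => f s t - f s t') (a s t - a s t') s :=
      fun s => (hfa s t).sub (hfa s t')
    have hdint : Integrable (fun s => f s t - f s t') := by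
      -- For almost every `s`, the difference is at most `∫ |b(s, τ)| dτ`, which is integrable in
      -- `s` by Fubini.
      refine (hb.integral_norm_prod_left).mono'
        (continuous_iff_continuousAt.2 fun s => (hd s).continuousAt).aestronglyMeasurable ?_
      filter_upwards [hb.prod_right_ae] with s hs
      have hs' : Integrable (b s) := hs
      rw [← intervalIntegral.integral_eq_sub_of_hasDerivAt (fun x _ => hfb s x)
        hs'.intervalIntegrable]
      refine (intervalIntegral.norm_integral_le_integral_norm_uIoc).trans ?_
      exact setIntegral_le_integral hs'.norm (Filter.Eventually.of_forall fun _ => norm_nonneg _)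
    have h0 := integral_eq_zero_of_hasDerivAt_of_integrable hd (ht.sub ht') hdint
    rwa [integral_sub ht ht', sub_eq_zero] at h0
  obtain ⟨t₀, ht₀⟩ := hga.exists
  have hae : (fun t => ∫ s, a s t) =ᵐ[volume] fun _ => ∫ s, a s t₀ := by
    filter_upwards [hga] with t ht using hconst t t₀ ht ht₀
  -- A constant integrable over a line of infinite measure is zero.
  have hc : ∫ s, a s t₀ = 0 := by
    have hi : Integrable (fun t => ∫ s, a s t) := ha.integral_prod_right
    have := (integrable_congr hae).1 hi
    rw [integrable_const_iff] at this
    refine this.resolve_right fun hfin => ?_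
    have := hfin.measure_univ_lt_top
    simp at this
  rw [integral_prod_symm _ ha]
  simpa [hc] using integral_congr_ae hae

/-- For a differentiable function on `ℂ` with integrable gradient, `∂_s f` and `∂_t f` have
vanishing integral. -/
theorem Complex.integral_fderiv_apply_eq_zero {F : Type*} [NormedAddCommGroup F] [NormedSpace ℝ F]
    [CompleteSpace F] {f : ℂ → F} (hf : Differentiable ℝ f)
    (h1 : Integrable (fun z => fderiv ℝ f z 1)) (hI : Integrable (fun z => fderiv ℝ f z Complex.I)) :
    ∫ z, fderiv ℝ f z 1 = 0 ∧ ∫ z, fderiv ℝ f z Complex.I = 0 := by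
  have hmp := Complex.volume_preserving_equiv_real_prod.symm
  have hme := Complex.measurableEquivRealProd.symm.measurableEmbedding
  have hs : ∀ s t : ℝ, HasDerivAt (fun s : ℝ => f ⟨s, t⟩) (fderiv ℝ f ⟨s, t⟩ 1) s := by
    intro s t
    refine (hf ⟨s, t⟩).hasFDerivAt.comp_hasDerivAt s ?_
    have h := (Complex.ofRealCLM.hasDerivAt (x := s)).add_const ((t : ℂ) * Complex.I)
    have he : (fun s : ℝ => (⟨s, t⟩ : ℂ)) = fun s : ℝ => Complex.ofRealCLM s + t * Complex.I := by
      ext s; simp [Complex.mk_eq_add_mul_I]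
    rw [he]; simpa using h
  have ht : ∀ s t : ℝ, HasDerivAt (fun t : ℝ => f ⟨s, t⟩) (fderiv ℝ f ⟨s, t⟩ Complex.I) t := by
    intro s t
    refine (hf ⟨s, t⟩).hasFDerivAt.comp_hasDerivAt t ?_
    have h := ((Complex.ofRealCLM.hasDerivAt (x := t)).mul_const Complex.I).const_add (s : ℂ)
    have he : (fun t : ℝ => (⟨s, t⟩ : ℂ)) = fun t : ℝ => s + Complex.ofRealCLM t * Complex.I := by
      ext s; simp [Complex.mk_eq_add_mul_I]
    change HasDerivAt (fun t : ℝ => (⟨s, t⟩ : ℂ)) Complex.I t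
    rw [he]; simpa using h
  have h1' : Integrable (Function.uncurry fun s t : ℝ => fderiv ℝ f ⟨s, t⟩ 1)
      (volume.prod volume) := (hmp.integrable_comp_emb hme).2 h1
  have hI' : Integrable (Function.uncurry fun s t : ℝ => fderiv ℝ f ⟨s, t⟩ Complex.I)
      (volume.prod volume) := (hmp.integrable_comp_emb hme).2 hI
  constructor
  · rw [← hmp.integral_comp hme]
    exact integral_partialDeriv_eq_zero hs ht h1' hI'
  · rw [← hmp.integral_comp hme, Measure.volume_eq_prod, ← integral_prod_swap]
    exact integral_partialDeriv_eq_zero (fun s t => ht t s) (fun s t => hs t s) hI'.swap h1'.swap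

/-! ### The differential and gradient of the superpotential. -/

/-- A complex differentiable map between complex manifolds is real differentiable, with the same
derivative. -/
theorem HasMFDerivAt.restrictScalars_real {E E' M M' : Type*}
    [NormedAddCommGroup E] [NormedSpace ℂ E] [NormedAddCommGroup E'] [NormedSpace ℂ E']
    [TopologicalSpace M] [ChartedSpace E M] [TopologicalSpace M'] [ChartedSpace E' M']
    {f : M → M'} {x : M} {f' : E →L[ℂ] E'} (h : HasMFDerivAt 𝓘(ℂ, E) 𝓘(ℂ, E') f x f') :
    HasMFDerivAt 𝓘(ℝ, E) 𝓘(ℝ, E') f x (f'.restrictScalars ℝ) :=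
  ⟨h.1, h.2.restrictScalars ℝ⟩

noncomputable section

namespace GLSM
namespace GLSMSpace

variable {E : Type*} [NormedAddCommGroup E] [NormedSpace ℂ E] [FiniteDimensional ℂ E]
    {V : Type*} [TopologicalSpace V] [T2Space V] [SecondCountableTopology V] [ChartedSpace E V]
    [IsManifold 𝓘(ℂ, E) ω V] [NoncompactSpace V]
    {EG : Type*} [NormedAddCommGroup EG] [NormedSpace ℂ EG] [FiniteDimensional ℂ EG]
    {G : Type*} [TopologicalSpace G] [T2Space G] [ChartedSpace EG G] [Group G]
    [LieGroup 𝓘(ℂ, EG) ω G]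
    {EK : Type*} [NormedAddCommGroup EK] [NormedSpace ℝ EK] [FiniteDimensional ℝ EK]
    {K : Type*} [TopologicalSpace K] [T2Space K] [CompactSpace K] [ChartedSpace EK K] [Group K]
    [LieGroup 𝓘(ℝ, EK) ∞ K]
    [MulAction ℂˣ V] [ContMDiffSMul 𝓘(ℂ) 𝓘(ℂ, E) ω ℂˣ V]
    [MulAction G V] [ContMDiffSMul 𝓘(ℂ, EG) 𝓘(ℂ, E) ω G V] [SMulCommClass G ℂˣ V]
    (X : GLSMSpace E V EG G EK K)

/-- The complex derivative of the superpotential. -/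
def dW (x : V) : E →L[ℂ] ℂ := mfderiv 𝓘(ℂ, E) 𝓘(ℂ) X.W x

theorem hasMFDerivAt_W (x : V) :
    HasMFDerivAt 𝓘(ℝ, E) 𝓘(ℝ, ℂ) X.W x ((X.dW x).restrictScalars ℝ) :=
  HasMFDerivAt.restrictScalars_real (M' := ℂ)
    ((X.W_holomorphic.mdifferentiable (by simp)) x).hasMFDerivAt

theorem inner_gradW (x : V) (v : TangentSpace 𝓘(ℝ, E) x) :
    X.kahler.metric.inner x (X.gradW x) v = (X.dW x v).re := by
  rw [X.gradW_spec]
  have h : HasMFDerivAt 𝓘(ℝ, E) 𝓘(ℝ) (fun y => (X.W y).re) x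
      (Complex.reCLM.comp ((X.dW x).restrictScalars ℝ)) :=
    HasMFDerivAt.comp x (Complex.reCLM.hasFDerivAt.hasMFDerivAt) (X.hasMFDerivAt_W x)
  rw [h.mfderiv]; rfl

theorem dW_J (x : V) (v : TangentSpace 𝓘(ℝ, E) x) :
    X.dW x (J x v) = Complex.I * X.dW x v :=
  (X.dW x).map_smul Complex.I v

theorem im_dW (x : V) (v : TangentSpace 𝓘(ℝ, E) x) :
    (X.dW x v).im = - X.kahler.metric.inner x (X.gradW x) (J x v) := by
  rw [inner_gradW, dW_J]; simp

/-- `W` is constant along `K`-orbits, so the chain rule along the orbit map gives zero. -/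
theorem dW_infAction (ξ : EK) (x : V) : X.dW x (infAction X.ι ξ x) = 0 := by
  by_cases hd : MDifferentiableAt 𝓘(ℝ, EK) 𝓘(ℝ, E) (fun k : K => X.ι k • x) 1
  · have hx : (fun k : K => X.ι k • x) 1 = x := by simp
    have hW := X.hasMFDerivAt_W ((fun k : K => X.ι k • x) 1)
    have h := hW.comp (1 : K) hd.hasMFDerivAt
    have hc : X.W ∘ (fun k : K => X.ι k • x) = fun _ => X.W x := by
      ext k; exact X.W_invariant _ _
    rw [hc] at h
    have h0 := hasMFDerivAt_unique h (hasMFDerivAt_const (X.W x) (1 : K))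
    have h1 := congrArg (fun L => L ξ) h0
    have h2 : X.dW ((fun k : K => X.ι k • x) 1) (infAction X.ι ξ x) = 0 := h1
    rwa [hx] at h2
  -- Without differentiability of the orbit map, `mfderiv` takes its default value zero, so the
  -- claim still holds.
  · have : infAction (E := E) X.ι ξ x = 0 := by
      unfold infAction; rw [mfderiv_zero_of_not_mdifferentiableAt hd]; rfl
    rw [this]; exact map_zero (X.dW x)

theorem normSq_nonneg (x : V) (v : TangentSpace 𝓘(ℝ, E) x) : 0 ≤ X.normSq x v := by
  by_cases hv : v = 0
  · simp [normSq, hv]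
  · exact (X.kahler.metric.pos x v hv).le

theorem kInner_self_nonneg (ξ : EK) : 0 ≤ X.kInner ξ ξ := by
  by_cases h : ξ = 0
  · simp [h]
  · exact (X.kInner_pos ξ h).le

/-- Expand `|v ± w|² ≥ 0`. The arithmetic-mean form is preferred to Cauchy–Schwarz because its right
side is made of terms of the energy density. -/
theorem two_mul_abs_inner_le (x : V) (v w : TangentSpace 𝓘(ℝ, E) x) :
    2 * |X.kahler.metric.inner x v w| ≤ X.normSq x v + X.normSq x w := by
  have hp := X.normSq_nonneg x (v + w)
  have hm := X.normSq_nonneg x (v - w)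
  have hs := X.kahler.metric.symm x v w
  simp only [normSq, map_add, map_sub, add_apply,
    sub_apply] at hp hm ⊢
  rcases abs_cases (X.kahler.metric.inner x v w) with h | h <;> linarith

/-- The real and imaginary parts of `dW v` are, up to sign, the pairings of `∇W` with `v` and `J v`.
Each is at most half the right side, as `J` is an isometry. -/
theorem norm_dW_le (x : V) (v : TangentSpace 𝓘(ℝ, E) x) :
    ‖X.dW x v‖ ≤ X.normSq x (X.gradW x) + X.normSq x v := by
  have h1 := X.two_mul_abs_inner_le x (X.gradW x) v
  have h2 := X.two_mul_abs_inner_le x (X.gradW x) (J x v)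
  have h3 : X.normSq x (J x v) = X.normSq x v := X.kahler.inner_J x v v
  have h4 := Complex.norm_le_abs_re_add_abs_im (X.dW x v)
  rw [← X.inner_gradW, im_dW, abs_neg] at h4
  linarith

/-- The imaginary part vanishes because `∇W ⟂ J ∇W`, a consequence of `J` being orthogonal with `J²
= -1`. -/
theorem dW_gradW (x : V) : X.dW x (X.gradW x) = X.normSq x (X.gradW x) := by
  have hI : X.kahler.metric.inner x (X.gradW x) (J x (X.gradW x)) = 0 := by
    have h := X.kahler.inner_J x (X.gradW x) (J x (X.gradW x))
    have hJJ : J x (J x (X.gradW x)) = -X.gradW x := by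
      change Complex.I • (Complex.I • (show E from X.gradW x)) = -(show E from X.gradW x)
      rw [smul_smul, Complex.I_mul_I, neg_one_smul]
    rw [hJJ, map_neg, X.kahler.metric.symm] at h
    linarith
  apply Complex.ext
  · rw [← X.inner_gradW]; rfl
  · rw [im_dW, hI]; simp

/-! ### Energy bounds and the Cauchy–Riemann defect of `W ∘ u`. -/

variable {X} {u : ℂ → V} {φ ψ : ℂ → EK}

theorem normSq_covS_le_energyDensity (z : ℂ) :
    X.normSq (u z) (X.gradW (u z)) + X.normSq (u z) (X.covS u φ z)
      ≤ 2 * X.energyDensity u φ ψ z := by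
  have h1 := X.normSq_nonneg (u z) (X.covT u ψ z)
  have h2 := X.kInner_self_nonneg (X.curvature φ ψ z)
  have h3 := X.kInner_self_nonneg (X.sharp (X.μ (u z)))
  have h4 := X.normSq_nonneg (u z) (X.gradW (u z))
  unfold energyDensity; linarith

theorem normSq_covT_le_energyDensity (z : ℂ) :
    X.normSq (u z) (X.gradW (u z)) + X.normSq (u z) (X.covT u ψ z)
      ≤ 2 * X.energyDensity u φ ψ z := by
  have h1 := X.normSq_nonneg (u z) (X.covS u φ z)
  have h2 := X.kInner_self_nonneg (X.curvature φ ψ z)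
  have h3 := X.kInner_self_nonneg (X.sharp (X.μ (u z)))
  have h4 := X.normSq_nonneg (u z) (X.gradW (u z))
  unfold energyDensity; linarith

/-- For finite energy, a continuous function dominated by the energy density is integrable. -/
theorem integrable_of_norm_le_energyDensity (hE : X.energy u φ ψ < ⊤) {g : ℂ → ℂ}
    (hg : Continuous g) (hle : ∀ z, ‖g z‖ ≤ 2 * X.energyDensity u φ ψ z) : Integrable g := by
  refine ⟨hg.aestronglyMeasurable, ?_⟩
  rw [hasFiniteIntegral_iff_norm]
  calc ∫⁻ z, ENNReal.ofReal ‖g z‖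
      ≤ ∫⁻ z, 2 * ENNReal.ofReal (X.energyDensity u φ ψ z) := by
        refine lintegral_mono fun z => (ENNReal.ofReal_le_ofReal (hle z)).trans ?_
        rw [ENNReal.ofReal_mul (by norm_num)]; simp
    _ = 2 * X.energy u φ ψ := lintegral_const_mul' _ _ (by simp)
    _ < ⊤ := ENNReal.mul_lt_top (by simp) hE

theorem contMDiff_W : ContMDiff 𝓘(ℝ, E) 𝓘(ℝ, ℂ) ∞ X.W := by
  intro x
  have h := X.W_holomorphic x
  rw [contMDiffAt_iff] at h ⊢
  exact ⟨h.1, ContDiffWithinAt.of_le (ContDiffWithinAt.restrict_scalars ℝ h.2) le_top⟩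

theorem fderiv_W_comp (hu : ContMDiff 𝓘(ℝ, ℂ) 𝓘(ℝ, E) ∞ u) (z v : ℂ) :
    fderiv ℝ (fun z => X.W (u z)) z v = X.dW (u z) (mfderiv 𝓘(ℝ, ℂ) 𝓘(ℝ, E) u z v) := by
  have h := (X.hasMFDerivAt_W (u z)).comp z ((hu.mdifferentiable (by simp)) z).hasMFDerivAt
  let du : ℂ →L[ℝ] E := mfderiv 𝓘(ℝ, ℂ) 𝓘(ℝ, E) u z
  have h' : HasFDerivAt (fun z => X.W (u z)) (((X.dW (u z)).restrictScalars ℝ).comp du) z :=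
    hasMFDerivAt_iff_hasFDerivAt.1 h
  rw [h'.fderiv]; rfl

/-- Derivatives of `W ∘ u` only see the covariant derivatives of `u`. -/
theorem fderiv_W_comp_one (hu : ContMDiff 𝓘(ℝ, ℂ) 𝓘(ℝ, E) ∞ u) (φ : ℂ → EK) (z : ℂ) :
    fderiv ℝ (fun z => X.W (u z)) z 1 = X.dW (u z) (X.covS u φ z) := by
  rw [fderiv_W_comp hu]
  have h := (X.dW (u z)).map_add (mfderiv 𝓘(ℝ, ℂ) 𝓘(ℝ, E) u z (1 : ℂ))
    (infAction X.ι (φ z) (u z))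
  rw [X.dW_infAction, add_zero] at h
  exact h.symm

theorem fderiv_W_comp_I (hu : ContMDiff 𝓘(ℝ, ℂ) 𝓘(ℝ, E) ∞ u) (ψ : ℂ → EK) (z : ℂ) :
    fderiv ℝ (fun z => X.W (u z)) z Complex.I = X.dW (u z) (X.covT u ψ z) := by
  rw [fderiv_W_comp hu]
  have h := (X.dW (u z)).map_add (mfderiv 𝓘(ℝ, ℂ) 𝓘(ℝ, E) u z Complex.I)
    (infAction X.ι (ψ z) (u z))
  rw [X.dW_infAction, add_zero] at h
  exact h.symm

/-- For a solution of the gauged Witten equation, `2 ∂̄ (W ∘ u) = -|∇W(u)|²`. -/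
theorem IsGaugedWittenSolution.dbar_W_comp (h : X.IsGaugedWittenSolution u φ ψ) (z : ℂ) :
    fderiv ℝ (fun z => X.W (u z)) z 1 + Complex.I * fderiv ℝ (fun z => X.W (u z)) z Complex.I
      = -X.normSq (u z) (X.gradW (u z)) := by
  rw [fderiv_W_comp_one h.smooth_u φ, fderiv_W_comp_I h.smooth_u ψ, ← dW_J, ← dW_gradW]
  have h0 : X.dW (u z) (X.covS u φ z + J (u z) (X.covT u ψ z) + X.gradW (u z)) = 0 := by
    rw [h.witten_eq z]; exact map_zero (X.dW (u z))
  have h1 := (X.dW (u z)).map_add (X.covS u φ z + J (u z) (X.covT u ψ z) : E) (X.gradW (u z))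
  have h2 := (X.dW (u z)).map_add (X.covS u φ z) (J (u z) (X.covT u ψ z))
  exact eq_neg_of_add_eq_zero_left ((congrArg (· + _) h2.symm).trans (h1.symm.trans h0))

theorem IsPointlikeInstanton.gradW_eq_zero (h : X.IsPointlikeInstanton u φ ψ) (z : ℂ) :
    X.gradW (u z) = 0 := by
  have hu := h.solution.smooth_u
  set f : ℂ → ℂ := fun z => X.W (u z) with hf
  have hfs : ContDiff ℝ ∞ f := (contMDiff_W.comp hu).contDiff
  have hc : Continuous (fderiv ℝ f) := hfs.continuous_fderiv (by simp)
  have hc1 : Continuous fun z => fderiv ℝ f z 1 := hc.clm_apply continuous_const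
  have hcI : Continuous fun z => fderiv ℝ f z Complex.I := hc.clm_apply continuous_const
  have hi1 : Integrable fun z => fderiv ℝ f z 1 :=
    integrable_of_norm_le_energyDensity h.finite_energy hc1 fun z => by
      rw [hf, fderiv_W_comp_one hu φ]
      exact (X.norm_dW_le _ _).trans (normSq_covS_le_energyDensity z)
  have hiI : Integrable fun z => fderiv ℝ f z Complex.I :=
    integrable_of_norm_le_energyDensity h.finite_energy hcI fun z => by
      rw [hf, fderiv_W_comp_I hu ψ]
      exact (X.norm_dW_le _ _).trans (normSq_covT_le_energyDensity z)
  obtain ⟨h1, hI⟩ := Complex.integral_fderiv_apply_eq_zero (hfs.differentiable (by simp)) hi1 hiI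
  have hdbar : ∀ z, fderiv ℝ f z 1 + Complex.I * fderiv ℝ f z Complex.I
      = ((-X.normSq (u z) (X.gradW (u z)) : ℝ) : ℂ) := fun z => by
    rw [h.solution.dbar_W_comp z]; simp
  -- `gradW` is chosen pointwise, so its definition carries no regularity; continuity and
  -- integrability of `|∇W(u)|²` are read off from the derivatives of the smooth function `f`.
  have hN : (fun z => X.normSq (u z) (X.gradW (u z)))
      = fun z => -(fderiv ℝ f z 1 + Complex.I * fderiv ℝ f z Complex.I).re := by
    ext z; rw [hdbar z]; simp
  have hNc : Continuous fun z => X.normSq (u z) (X.gradW (u z)) := by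
    rw [hN]
    exact (Complex.continuous_re.comp (hc1.add (continuous_const.mul hcI))).neg
  have hsum : Integrable fun z => fderiv ℝ f z 1 + Complex.I * fderiv ℝ f z Complex.I :=
    hi1.add (hiI.const_mul _)
  have hNi : Integrable fun z => X.normSq (u z) (X.gradW (u z)) := by
    rw [hN]; exact hsum.re.neg
  have hint : ∫ z, X.normSq (u z) (X.gradW (u z)) = 0 := by
    have h2 : ∫ z, (fderiv ℝ f z 1 + Complex.I * fderiv ℝ f z Complex.I) = 0 := by
      rw [integral_add hi1 (hiI.const_mul _), integral_const_mul, h1, hI]; simp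
    simp_rw [hdbar] at h2
    rw [integral_complex_ofReal, integral_neg] at h2
    simpa using h2
  have hz : X.normSq (u z) (X.gradW (u z)) = 0 :=
    by
    -- Vanishing almost everywhere upgrades to vanishing everywhere by continuity.
    have hae := (integral_eq_zero_iff_of_nonneg (fun z => X.normSq_nonneg _ _) hNi).1 hint
    exact congrFun ((hNc.ae_eq_iff_eq volume continuous_const).1 hae) z
  by_contra hne
  exact (X.kahler.metric.pos (u z) _ hne).ne' hz

end GLSMSpace
end GLSM
end

theorem proposition2p8
    {E : Type*} [NormedAddCommGroup E] [NormedSpace ℂ E] [FiniteDimensional ℂ E]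
    {V : Type*} [TopologicalSpace V] [T2Space V] [SecondCountableTopology V] [ChartedSpace E V]
    [IsManifold 𝓘(ℂ, E) ω V] [NoncompactSpace V]
    {EG : Type*} [NormedAddCommGroup EG] [NormedSpace ℂ EG] [FiniteDimensional ℂ EG]
    {G : Type*} [TopologicalSpace G] [T2Space G] [ChartedSpace EG G] [Group G]
    [LieGroup 𝓘(ℂ, EG) ω G]
    {EK : Type*} [NormedAddCommGroup EK] [NormedSpace ℝ EK] [FiniteDimensional ℝ EK]
    {K : Type*} [TopologicalSpace K] [T2Space K] [CompactSpace K] [ChartedSpace EK K] [Group K]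
    [LieGroup 𝓘(ℝ, EK) ∞ K]
    [MulAction ℂˣ V] [ContMDiffSMul 𝓘(ℂ) 𝓘(ℂ, E) ω ℂˣ V]
    [MulAction G V] [ContMDiffSMul 𝓘(ℂ, EG) 𝓘(ℂ, E) ω G V] [SMulCommClass G ℂˣ V]
    (X : GLSM.GLSMSpace E V EG G EK K)
    (u : ℂ → V) (φ ψ : ℂ → EK) (h : X.IsPointlikeInstanton u φ ψ) :
    (∀ z : ℂ, X.gradW (u z) = 0) ∧ X.IsAffineVortex u φ ψ := by
  refine ⟨h.gradW_eq_zero, h.solution.smooth_u, h.solution.smooth_φ, h.solution.smooth_ψ,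
    fun z => ?_, h.solution.curvature_eq⟩
  have hz := h.solution.witten_eq z
  rwa [h.gradW_eq_zero z, add_zero] at hz
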